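/- Let $\theta\ge 1$ be an integer. A hyperrecursive tree with hyperedge size $\theta$ is the random hypergraph process that starts at time $0$ with $\theta$ originating vertices, all labeled $0$, which form the only hyperedge. At each time $n\ge 1$ a new vertex, labeled $n$, joins: it chooses $\theta-1$ of the $n-1+\theta$ existing vertices uniformly at random, all subsets of size $\theta-1$ being equally likely independently of the past, and together with them it forms a new hyperedge. For $0\le k\le n$ let $C_{n,k}$ be the containment level of the vertex labeled $k$ at time $n$, that is, the number of hyperedges at time $n$ that contain it; for $k=0$ this refers to any one of the originating vertices. Let $n\to\infty$, and let $k$ be fixed in (i) and $k=k(n)\in\{0,\dots,n\}$ in (ii)–(iv). (i) If $k$ is fixed, then $$\frac{C_{n,k}-(\theta-1)\ln n}{\sqrt{\ln n}}\longrightarrow N(0,\theta-1)\quad\text{in distribution.}$$ (ii) If $k\to\infty$ and $k=o(n)$, then $$\frac{C_{n,k}-(\theta-1)\ln (n/k)}{\sqrt{\ln (n/k)}}\longrightarrow N(0,\theta-1)\quad\text{in distribution.}$$ (iii) If $k\sim\alpha n$ with a constant $0<\alpha<1$, then $$C_{n,k}\longrightarrow 1+\mathrm{Poi}\big((\theta-1)\ln(1/\alpha)\big)\quad\text{in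 distribution.}$$ (iv) If $k=n-o(n)$, then $C_{n,k}\to 1$ in probability. Here $N(0,\sigma^2)$ is the normal distribution with mean $0$ and variance $\sigma^2$ and $\mathrm{Poi}(\lambda)$ is the Poisson distribution with mean $\lambda$; for $\theta=1$ both $N(0,0)$ and $\mathrm{Poi}(0)$ are the point mass at $0$. -/

import Mathlib

open MeasureTheory ProbabilityTheory Filter Asymptotics
open scoped NNReal

namespace HyperrecursiveTree

/-- The vertices present at time `n`: the originators are `0, …, θ - 1`, and the vertex that joins
at time `m ≥ 1` is `θ + m - 1`. -/
def vertices (θ n : ℕ) : Finset ℕ := Finset.range (n + θ)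

/-- The label of a vertex: `0` for each originator `v < θ`, and `m` for the vertex `θ + m - 1`
that joins at time `m ≥ 1` (the subtraction is meant to truncate). -/
def label (θ v : ℕ) : ℕ := v + 1 - θ

/-- The possible choices at step `n + 1`: the `(θ - 1)`-element subsets of the vertices present
at time `n`. -/
def Choice (θ n : ℕ) : Type := {S : Finset ℕ // S ∈ (vertices θ n).powersetCard (θ - 1)}

instance (θ n : ℕ) : Fintype (Choice θ n) :=
  inferInstanceAs (Fintype {S : Finset ℕ // S ∈ (vertices θ n).powersetCard (θ - 1)})

instance (θ n : ℕ) : Nonempty (Choice θ n) := by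
  have h : ((vertices θ n).powersetCard (θ - 1)).Nonempty := by
    rw [Finset.powersetCard_nonempty, vertices, Finset.card_range]
    omega
  exact h.to_subtype

instance (θ n : ℕ) : MeasurableSpace (Choice θ n) := ⊤

/-- The law of the growth: at each step `n + 1` the chosen subset is, independently of the history,
uniformly distributed over the `(θ - 1)`-element subsets of the vertices present at time `n`. -/
noncomputable def growthLaw (θ : ℕ) : Measure (∀ n, Choice θ n) :=
  Measure.infinitePi fun n => (PMF.uniformOfFintype (Choice θ n)).toMeasure

instance (θ : ℕ) : IsProbabilityMeasure (growthLaw θ) :=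
  inferInstanceAs (IsProbabilityMeasure
    (Measure.infinitePi fun n => (PMF.uniformOfFintype (Choice θ n)).toMeasure))

/-- The set of hyperedges of the hyperrecursive tree at time `n`, given the choices `ω`: at time `0`
the `θ` originators form the only hyperedge; at step `n + 1` the new vertex `n + θ` and the chosen
`θ - 1` existing vertices form a new hyperedge. -/
def hyperedges (θ : ℕ) (ω : ∀ n, Choice θ n) : ℕ → Finset (Finset ℕ)
  | 0 => {vertices θ 0}
  | n + 1 => insert (insert (n + θ) (ω n).1) (hyperedges θ ω n)

/-- The containment level of the vertex `v` at time `n`: the number of hyperedges containing `v`. -/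
def containment (θ n v : ℕ) (ω : ∀ n, Choice θ n) : ℕ :=
  ((hyperedges θ ω n).filter fun e => v ∈ e).card

end HyperrecursiveTree

open scoped Topology

namespace HyperrecursiveTree

/-! ### Poisson approximation, harmonic sums and the Gaussian limit -/

section Analysis

/-! A vertex labeled `k` lies in one hyperedge at birth, and each later step `m + 1` (with `k ≤ m <
n`) adds one exactly when it is among the `θ - 1` vertices chosen out of `m + θ`. So `C - 1` is a
sum of independent Bernoulli variables with parameters `p_m = (θ - 1) / (m + θ)` and mean `Λ = ∑
p_m`, which is close to `(θ - 1) log ((n + θ) / (k + θ))`.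

The characteristic function of this sum at `u` differs from that of `Poi(Λ)` by at most `‖e^{iu} -
1‖² e² ∑ p_m²`, and `∑ p_m² ≤ 2 (θ - 1)² / (k + θ)` (`norm_charFun_sub_exp_le`). In (i) and (ii), `u
= t / √L → 0` makes the error vanish even for bounded `k`, and a Poisson law of mean `(θ - 1) L +
O(1)`, centred and scaled, tends to the Gaussian (`tendsto_gaussian_exponent`). In (iii) `u` is
fixed, but `k → ∞` and `Λ` converges. Lévy's continuity theorem concludes. For (iv) a union bound
suffices: `P(C ≠ 1) ≤ Λ → 0`. -/

lemma norm_prod_sub_prod_le {ι : Type*} (s : Finset ι) (a b : ι → ℂ)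
    (ha : ∀ i ∈ s, ‖a i‖ ≤ 1) (hb : ∀ i ∈ s, ‖b i‖ ≤ 1) :
    ‖∏ i ∈ s, a i - ∏ i ∈ s, b i‖ ≤ ∑ i ∈ s, ‖a i - b i‖ := by
  classical
  induction s using Finset.induction_on with
  | empty => simp
  | insert j s hj ih =>
    rw [Finset.prod_insert hj, Finset.prod_insert hj, Finset.sum_insert hj]
    have hB : ‖∏ i ∈ s, b i‖ ≤ 1 := by
      rw [norm_prod]
      exact Finset.prod_le_one (fun _ _ => norm_nonneg _)
        fun i hi => hb i (Finset.mem_insert_of_mem hi)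
    have ih' := ih (fun i hi => ha i (Finset.mem_insert_of_mem hi))
      (fun i hi => hb i (Finset.mem_insert_of_mem hi))
    have hj1 := ha j (Finset.mem_insert_self _ _)
    calc ‖a j * ∏ i ∈ s, a i - b j * ∏ i ∈ s, b i‖
        = ‖(a j - b j) * ∏ i ∈ s, b i + a j * (∏ i ∈ s, a i - ∏ i ∈ s, b i)‖ := by
          congr 1; ring
      _ ≤ ‖a j - b j‖ * ‖∏ i ∈ s, b i‖ + ‖a j‖ * ‖∏ i ∈ s, a i - ∏ i ∈ s, b i‖ := by
          rw [← norm_mul, ← norm_mul]; exact norm_add_le _ _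
      _ ≤ ‖a j - b j‖ * 1 + 1 * ‖∏ i ∈ s, a i - ∏ i ∈ s, b i‖ := by gcongr
      _ ≤ _ := by linarith

lemma norm_exp_I_mul_sub_one_le_two (u : ℝ) : ‖Complex.exp (u * Complex.I) - 1‖ ≤ 2 := by
  calc _ ≤ ‖Complex.exp (u * Complex.I)‖ + ‖(1 : ℂ)‖ := norm_sub_le _ _
    _ = 2 := by rw [Complex.norm_exp_ofReal_mul_I]; norm_num

/-- Poisson approximation of a product of characteristic functions of Bernoulli laws. -/
lemma norm_prod_bernoulli_sub_exp_le {ι : Type*} (s : Finset ι) (p : ι → ℝ)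
    (hp0 : ∀ i ∈ s, 0 ≤ p i) (hp1 : ∀ i ∈ s, p i ≤ 1) (u : ℝ) :
    ‖∏ i ∈ s, (1 + (p i : ℂ) * (Complex.exp (u * Complex.I) - 1)) -
      Complex.exp ((Complex.exp (u * Complex.I) - 1) * ((∑ i ∈ s, p i : ℝ) : ℂ))‖ ≤
      ‖Complex.exp (u * Complex.I) - 1‖ ^ 2 * Real.exp 2 * ∑ i ∈ s, p i ^ 2 := by
  set z : ℂ := Complex.exp (u * Complex.I) - 1 with hz
  have hz2 : ‖z‖ ≤ 2 := norm_exp_I_mul_sub_one_le_two u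
  have hre : z.re ≤ 0 := by
    have h := Complex.re_le_norm (Complex.exp (u * Complex.I))
    rw [Complex.norm_exp_ofReal_mul_I] at h
    rw [hz, Complex.sub_re, Complex.one_re]
    linarith
  have hexp : Complex.exp (z * ((∑ i ∈ s, p i : ℝ) : ℂ)) = ∏ i ∈ s, Complex.exp (p i * z) := by
    rw [← Complex.exp_sum, Complex.ofReal_sum, Finset.mul_sum]
    simp_rw [mul_comm z]
  rw [hexp, Finset.mul_sum]
  refine (norm_prod_sub_prod_le s _ _ (fun i hi => ?_) (fun i hi => ?_)).trans
    (Finset.sum_le_sum fun i hi => ?_)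
  -- A convex combination of `1` and a point of the unit circle.
  · have : 1 + (p i : ℂ) * z = ((1 - p i : ℝ) : ℂ) + (p i : ℂ) * Complex.exp (u * Complex.I) := by
      rw [hz]; push_cast; ring
    rw [this]
    refine (norm_add_le _ _).trans ?_
    rw [norm_mul, Complex.norm_exp_ofReal_mul_I, Complex.norm_real, Complex.norm_real,
      Real.norm_of_nonneg (hp0 i hi), Real.norm_of_nonneg (by linarith [hp1 i hi])]
    linarith
  · rw [Complex.norm_exp, Complex.re_ofReal_mul]
    exact Real.exp_le_one_iff.2 (mul_nonpos_of_nonneg_of_nonpos (hp0 i hi) hre)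
  · have hn : ‖(p i : ℂ) * z‖ = p i * ‖z‖ := by
      rw [norm_mul, Complex.norm_real, Real.norm_of_nonneg (hp0 i hi)]
    -- Second-order Taylor remainder; the constant `exp 2` comes from `p i ≤ 1` and `‖z‖ ≤ 2`.
    have h := Complex.norm_exp_sub_sum_le_norm_mul_exp ((p i : ℂ) * z) 2
    have hs : ∑ m ∈ Finset.range 2, ((p i : ℂ) * z) ^ m / (m.factorial : ℂ) = 1 + p i * z := by
      simp [Finset.sum_range_succ]
    rw [hs, norm_sub_rev, hn] at h
    refine h.trans ?_
    have : p i * ‖z‖ ≤ 2 := by nlinarith [hp0 i hi, hp1 i hi, norm_nonneg z]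
    calc (p i * ‖z‖) ^ 2 * Real.exp (p i * ‖z‖) ≤ (p i * ‖z‖) ^ 2 * Real.exp 2 := by gcongr
      _ = _ := by ring

/-- Both bounds are `log y ≤ y - 1`, at `y = (x + 1) / x` and `y = x / (x + 1)`. The upper bound is
left as a difference so that it telescopes when summed. -/
lemma inv_sub_log_bounds {x : ℝ} (hx : 0 < x) :
    0 ≤ 1 / x - (Real.log (x + 1) - Real.log x) ∧
      1 / x - (Real.log (x + 1) - Real.log x) ≤ 1 / x - 1 / (x + 1) := by
  have h1 : Real.log (x + 1) - Real.log x ≤ 1 / x := by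
    rw [← Real.log_div (by positivity) hx.ne']
    refine (Real.log_le_sub_one_of_pos (by positivity)).trans (le_of_eq ?_)
    field_simp; ring
  have h2 : 1 / (x + 1) ≤ Real.log (x + 1) - Real.log x := by
    have := Real.log_le_sub_one_of_pos (show 0 < x / (x + 1) by positivity)
    rw [Real.log_div hx.ne' (by positivity)] at this
    have h3 : x / (x + 1) - 1 = - (1 / (x + 1)) := by field_simp; ring
    linarith
  constructor <;> linarith

lemma sum_inv_sub_log_bounds {θ k n : ℕ} (hθ : 1 ≤ θ) (hkn : k ≤ n) :
    0 ≤ ∑ m ∈ Finset.Ico k n, 1 / ((m : ℝ) + θ) -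
        (Real.log ((n : ℝ) + θ) - Real.log ((k : ℝ) + θ)) ∧
      ∑ m ∈ Finset.Ico k n, 1 / ((m : ℝ) + θ) -
        (Real.log ((n : ℝ) + θ) - Real.log ((k : ℝ) + θ)) ≤ 1 / ((k : ℝ) + θ) - 1 / ((n : ℝ) + θ) := by
  have hθ' : (1 : ℝ) ≤ θ := by exact_mod_cast hθ
  induction n, hkn using Nat.le_induction with
  | base => simp
  | succ n hkn ih =>
    rw [Finset.sum_Ico_succ_top hkn]
    have h := inv_sub_log_bounds (show (0 : ℝ) < n + θ by positivity)
    have e : ((n + 1 : ℕ) : ℝ) + θ = n + θ + 1 := by push_cast; ring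
    rw [e]
    constructor <;> linarith [h.1, h.2, ih.1, ih.2]

lemma sum_inv_sq_le {θ k n : ℕ} (hθ : 1 ≤ θ) (hkn : k ≤ n) :
    ∑ m ∈ Finset.Ico k n, (1 / ((m : ℝ) + θ)) ^ 2 ≤
      2 * (1 / ((k : ℝ) + θ) - 1 / ((n : ℝ) + θ)) := by
  have hθ' : (1 : ℝ) ≤ θ := by exact_mod_cast hθ
  induction n, hkn using Nat.le_induction with
  | base => simp
  | succ n hkn ih =>
    rw [Finset.sum_Ico_succ_top hkn]
    have e : ((n + 1 : ℕ) : ℝ) + θ = n + θ + 1 := by push_cast; ring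
    rw [e]
    have hx : (1 : ℝ) ≤ n + θ := by linarith [n.cast_nonneg (α := ℝ)]
    generalize (n : ℝ) + θ = x at *
    have hx0 : 0 < x := by linarith
    -- The factor `2` pays for `x + 1 ≤ 2 * x`, valid since `x ≥ 1`.
    have : (1 / x) ^ 2 ≤ 2 * (1 / x - 1 / (x + 1)) := by
      have : 2 * (1 / x - 1 / (x + 1)) = 2 / (x * (x + 1)) := by field_simp; ring
      rw [this, one_div, inv_pow, ← one_div, div_le_div_iff₀ (by positivity) (by positivity)]
      nlinarith
    linarith

lemma log_add_sub_log_bounds {x a : ℝ} (hx : 1 ≤ x) (ha : 0 ≤ a) :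
    0 ≤ Real.log (x + a) - Real.log x ∧ Real.log (x + a) - Real.log x ≤ Real.log (1 + a) := by
  have hx0 : 0 < x := by linarith
  constructor
  · linarith [Real.log_le_log hx0 (show x ≤ x + a by linarith)]
  · have := Real.log_le_log (show 0 < x + a by linarith) (show x + a ≤ x * (1 + a) by nlinarith)
    rw [Real.log_mul hx0.ne' (by positivity)] at this
    linarith

/-- The exponent of the Poisson approximation, after centring and scaling, tends to the
exponent of the Gaussian characteristic function. -/
lemma tendsto_gaussian_exponent {c K : ℝ} (hc : 0 ≤ c) {L Λ : ℕ → ℝ}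
    (hL : Tendsto L atTop atTop) (hΛ : ∀ᶠ n in atTop, |Λ n - c * L n| ≤ K) (t : ℝ) :
    Tendsto (fun n => (t / √(L n) : ℝ) * (1 - c * L n : ℝ) * Complex.I +
      (Complex.exp ((t / √(L n) : ℝ) * Complex.I) - 1) * (Λ n : ℂ)) atTop
      (𝓝 (-((c * t ^ 2 / 2 : ℝ) : ℂ))) := by
  have hu : Tendsto (fun n => t / √(L n)) atTop (𝓝 0) :=
    tendsto_const_nhds.div_atTop (Real.tendsto_sqrt_atTop.comp hL)
  have huC : Tendsto (fun n => ((t / √(L n) : ℝ) : ℂ) * Complex.I) atTop (𝓝 0) := by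
    simpa using ((Complex.continuous_ofReal.tendsto 0).comp hu).mul_const Complex.I
  have hz : Tendsto (fun n => Complex.exp ((t / √(L n) : ℝ) * Complex.I) - 1) atTop (𝓝 0) := by
    simpa using ((Complex.continuous_exp.tendsto 0).comp huC).sub_const 1
  -- Replacing `Λ` by `c * L` costs a bounded amount times a factor tending to `0`.
  have hA : Tendsto (fun n => (Complex.exp ((t / √(L n) : ℝ) * Complex.I) - 1) *
      ((Λ n - c * L n : ℝ) : ℂ)) atTop (𝓝 0) := by
    refine squeeze_zero_norm' (a := fun n => ‖Complex.exp ((t / √(L n) : ℝ) * Complex.I) - 1‖ * K)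
      ?_ (by simpa using hz.norm.mul_const K)
    filter_upwards [hΛ] with n hn
    rw [norm_mul, Complex.norm_real, Real.norm_eq_abs]
    gcongr
  -- Third-order remainder of `exp`: with `u = t / √L`, the relation `u² L = t²` leaves a bound of
  -- order `|u|`.
  have hB : Tendsto (fun n => (Complex.exp ((t / √(L n) : ℝ) * Complex.I) -
      (1 + (t / √(L n) : ℝ) * Complex.I + ((t / √(L n) : ℝ) * Complex.I) ^ 2 / 2)) *
      ((c * L n : ℝ) : ℂ)) atTop (𝓝 0) := by
    refine squeeze_zero_norm' (a := fun n => c * t ^ 2 * (|t / √(L n)| * Real.exp |t / √(L n)|))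
      ?_ ?_
    · filter_upwards [hL.eventually_gt_atTop 0] with n hn
      have h := Complex.norm_exp_sub_sum_le_norm_mul_exp ((t / √(L n) : ℝ) * Complex.I) 3
      rw [Finset.sum_range_succ, Finset.sum_range_succ, Finset.sum_range_one] at h
      simp only [pow_zero, Nat.factorial, Nat.cast_one, div_one, pow_one, mul_one]
        at h
      rw [norm_mul (_ : ℂ) Complex.I, Complex.norm_I, mul_one, Complex.norm_real,
        Real.norm_eq_abs] at h
      rw [norm_mul, Complex.norm_real, Real.norm_of_nonneg (by positivity)]
      refine (mul_le_mul_of_nonneg_right h (by positivity)).trans (le_of_eq ?_)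
      have h2 : |t / √(L n)| ^ 2 * L n = t ^ 2 := by
        rw [sq_abs, div_pow, Real.sq_sqrt hn.le]; field_simp
      rw [← h2]; ring
    · have := (hu.abs.mul ((Real.continuous_exp.tendsto _).comp hu.abs)).const_mul (c * t ^ 2)
      simpa using this
  -- The linear Taylor term cancels the centring, and the quadratic one is exactly `-c t² / 2`.
  have hC := ((huC.add hA).add hB).add_const (-((c * t ^ 2 / 2 : ℝ) : ℂ))
  simp only [zero_add, add_zero] at hC
  refine hC.congr' ?_
  filter_upwards [hL.eventually_gt_atTop 0] with n hn
  have h2 : ((t / √(L n) : ℝ) : ℂ) ^ 2 * (L n : ℂ) = (t : ℂ) ^ 2 := by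
    have : (t / √(L n)) ^ 2 * L n = t ^ 2 := by
      rw [div_pow, Real.sq_sqrt hn.le]; field_simp
    exact_mod_cast this
  rw [mul_pow, Complex.I_sq]
  push_cast at h2 ⊢
  linear_combination (c / 2 : ℂ) * h2

end Analysis

/-! ### Containment level as a sum of indicators -/

section Combinatorics

instance (θ n : ℕ) : DiscreteMeasurableSpace (Choice θ n) := ⟨fun _ => trivial⟩

/-- Ensures that the hyperedge inserted at each step is new, so that it is really counted, and that
no vertex is contained in a hyperedge before its birth. -/
lemma mem_lt_of_mem_hyperedges {θ : ℕ} (ω : ∀ n, Choice θ n) {n : ℕ} {e : Finset ℕ}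
    (he : e ∈ hyperedges θ ω n) {x : ℕ} (hx : x ∈ e) : x < n + θ := by
  induction n with
  | zero =>
    rw [hyperedges, Finset.mem_singleton] at he
    subst he
    simpa [vertices] using hx
  | succ n ih =>
    rw [hyperedges, Finset.mem_insert] at he
    rcases he with rfl | he
    · rcases Finset.mem_insert.1 hx with rfl | hx
      · omega
      · have := (Finset.mem_powersetCard.1 (ω n).2).1 hx
        rw [vertices, Finset.mem_range] at this
        omega
    · have := ih he
      omega

lemma containment_zero (θ v : ℕ) (ω : ∀ n, Choice θ n) :
    containment θ 0 v ω = if v < θ then 1 else 0 := by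
  simp [containment, hyperedges, vertices, Finset.filter_singleton, apply_ite Finset.card]

lemma containment_succ (θ n v : ℕ) (ω : ∀ n, Choice θ n) :
    containment θ (n + 1) v ω =
      containment θ n v ω + if v = n + θ ∨ v ∈ (ω n).1 then 1 else 0 := by
  have hnew : insert (n + θ) (ω n).1 ∉ hyperedges θ ω n := fun h =>
    (mem_lt_of_mem_hyperedges ω h (Finset.mem_insert_self _ _)).false
  rw [containment, hyperedges, Finset.filter_insert]
  simp only [Finset.mem_insert]
  split_ifs with h
  · rw [Finset.card_insert_of_notMem fun h' => hnew (Finset.mem_filter.1 h').1]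
    rfl
  · rfl

lemma containment_of_lt_label {θ n v : ℕ} (ω : ∀ n, Choice θ n) (h : n < label θ v) :
    containment θ n v ω = 0 := by
  rw [containment, Finset.card_eq_zero, Finset.filter_eq_empty_iff]
  intro e he hv
  have := mem_lt_of_mem_hyperedges ω he hv
  unfold label at h
  omega

/-- The indicator of the event that the choice `S` contains the vertex `v`. -/
noncomputable def chosen (θ v n : ℕ) (S : Choice θ n) : ℝ := if v ∈ S.1 then 1 else 0

lemma containment_eq_one_add_sum {θ n v : ℕ} (ω : ∀ n, Choice θ n)
    (h : label θ v ≤ n) :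
    (containment θ n v ω : ℝ) = 1 + ∑ m ∈ Finset.Ico (label θ v) n, chosen θ v m (ω m) := by
  induction n, h using Nat.le_induction with
  | base =>
    rw [Finset.Ico_self, Finset.sum_empty, add_zero, Nat.cast_eq_one]
    -- Label `0` means an originator, counted in the initial hyperedge; otherwise the single
    -- hyperedge is the one formed on arrival.
    rcases hk : label θ v with _ | k
    · rw [containment_zero, if_pos]
      unfold label at hk
      omega
    · rw [containment_succ, containment_of_lt_label ω (by omega), if_pos]
      unfold label at hk
      omega
  | succ n hn ih =>
    rw [Finset.sum_Ico_succ_top hn, containment_succ, Nat.cast_add, ih, chosen, add_assoc]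
    have : v ≠ n + θ := by
      unfold label at hn
      omega
    simp [this]

lemma card_choice (θ n : ℕ) : Fintype.card (Choice θ n) = (n + θ).choose (θ - 1) := by
  have : Fintype.card (Choice θ n) = ((vertices θ n).powersetCard (θ - 1)).card :=
    Fintype.card_coe _
  rw [this, Finset.card_powersetCard, vertices, Finset.card_range]

lemma card_choice_notMem {θ n v : ℕ} (hv : v < n + θ) :
    Fintype.card {S : Choice θ n | v ∉ S.1} = (n + θ - 1).choose (θ - 1) := by
  have h : Fintype.card {S : Choice θ n | v ∉ S.1} =
      (((vertices θ n).erase v).powersetCard (θ - 1)).card := by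
    rw [← Fintype.card_coe]
    refine Fintype.card_congr
      ⟨fun S => ⟨S.1.1, ?_⟩, fun S => ⟨⟨S.1, ?_⟩, ?_⟩, fun S => rfl, fun S => rfl⟩
    · have h1 := Finset.mem_powersetCard.1 S.1.2
      exact Finset.mem_powersetCard.2 ⟨Finset.subset_erase.2 ⟨h1.1, S.2⟩, h1.2⟩
    · have h1 := Finset.mem_powersetCard.1 S.2
      exact Finset.mem_powersetCard.2 ⟨(Finset.subset_erase.1 h1.1).1, h1.2⟩
    · exact (Finset.subset_erase.1 (Finset.mem_powersetCard.1 S.2).1).2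
  rw [h, Finset.card_powersetCard, Finset.card_erase_of_mem (by simpa [vertices] using hv),
    vertices, Finset.card_range]

/-- Via the complement: with `N + 1 = n + θ` vertices, the proportion of subsets avoiding `v` is `(N
+ 1 - (θ - 1)) / (N + 1)`. -/
lemma uniform_real_mem {θ n v : ℕ} (hθ : 1 ≤ θ) (hv : v < n + θ) :
    (PMF.uniformOfFintype (Choice θ n)).toMeasure.real {S | v ∈ S.1} =
      ((θ : ℝ) - 1) * (1 / ((n : ℝ) + θ)) := by
  have hc : {S : Choice θ n | v ∈ S.1} = {S | v ∉ S.1}ᶜ := by ext; simp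
  rw [hc, measureReal_compl (MeasurableSet.of_discrete), probReal_univ, measureReal_def,
    PMF.toMeasure_uniformOfFintype_apply _ MeasurableSet.of_discrete, card_choice_notMem hv,
    card_choice, ENNReal.toReal_div, ENNReal.toReal_natCast, ENNReal.toReal_natCast]
  obtain ⟨N, hN⟩ : ∃ N, n + θ = N + 1 := ⟨n + θ - 1, by omega⟩
  have hch := Nat.choose_mul_succ_eq N (θ - 1)
  have hpos : 0 < (N + 1).choose (θ - 1) := Nat.choose_pos (by omega)
  have hNR : (n : ℝ) + θ = N + 1 := by exact_mod_cast hN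
  rw [hN, hNR, Nat.add_sub_cancel]
  have hch' : (N.choose (θ - 1) : ℝ) * (N + 1) = (N + 1).choose (θ - 1) * (N + 1 - (θ - 1)) := by
    have h1 : ((N + 1 - (θ - 1) : ℕ) : ℝ) = N + 1 - (θ - 1) := by
      rw [Nat.cast_sub (by omega), Nat.cast_sub hθ]; push_cast; ring
    rw [← h1]
    exact_mod_cast hch
  have hpos' : (0 : ℝ) < (N + 1).choose (θ - 1) := by exact_mod_cast hpos
  field_simp
  linear_combination -hch'

end Combinatorics

/-! ### Characteristic functions and limit criteria -/

section Probability

lemma growthLaw_map_eval (θ n : ℕ) :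
    (growthLaw θ).map (fun ω => ω n) = (PMF.uniformOfFintype (Choice θ n)).toMeasure :=
  Measure.infinitePi_map_eval _ n

lemma growthLaw_real_mem {θ n v : ℕ} (hθ : 1 ≤ θ) (hv : v < n + θ) :
    (growthLaw θ).real {ω | v ∈ (ω n).1} = ((θ : ℝ) - 1) * (1 / ((n : ℝ) + θ)) := by
  rw [← uniform_real_mem hθ hv, ← growthLaw_map_eval,
    map_measureReal_apply (measurable_pi_apply n) MeasurableSet.of_discrete]
  rfl

lemma measurable_chosen (θ v n : ℕ) :
    Measurable fun ω : ∀ n, Choice θ n => chosen θ v n (ω n) :=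
  (Measurable.of_discrete (f := chosen θ v n)).comp (measurable_pi_apply n)

lemma measurable_containment (θ n v : ℕ) : Measurable (containment θ n v) := by
  induction n with
  | zero =>
    rw [show containment θ 0 v = fun _ => if v < θ then 1 else 0 from
      funext (containment_zero θ v)]
    exact measurable_const
  | succ n ih =>
    rw [show containment θ (n + 1) v = fun ω => _ from funext (containment_succ θ n v)]
    exact ih.add ((Measurable.of_discrete (f := fun S : Choice θ n =>
      if v = n + θ ∨ v ∈ S.1 then 1 else 0)).comp (measurable_pi_apply n))

lemma charFun_map_chosen {θ n v : ℕ} (hθ : 1 ≤ θ) (hv : v < n + θ) (t : ℝ) :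
    charFun ((growthLaw θ).map fun ω => chosen θ v n (ω n)) t =
      1 + ((((θ : ℝ) - 1) * (1 / ((n : ℝ) + θ)) : ℝ) : ℂ) * (Complex.exp (t * Complex.I) - 1) := by
  have hm : MeasurableSet {ω : ∀ n, Choice θ n | v ∈ (ω n).1} :=
    measurable_pi_apply n (MeasurableSet.of_discrete (s := {S : Choice θ n | v ∈ S.1}))
  rw [charFun_apply_real, integral_map (measurable_chosen θ v n).aemeasurable (by fun_prop)]
  have h : ∀ ω : ∀ n, Choice θ n, Complex.exp (t * (chosen θ v n (ω n) : ℝ) * Complex.I) =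
      1 + {ω : ∀ n, Choice θ n | v ∈ (ω n).1}.indicator
        (fun _ => Complex.exp (t * Complex.I) - 1) ω := by
    intro ω
    by_cases hω : v ∈ (ω n).1 <;> simp [chosen, hω]
  simp_rw [h]
  rw [integral_add (integrable_const _) ((integrable_const _).indicator hm),
    integral_indicator_const _ hm, growthLaw_real_mem hθ hv]
  simp

lemma charFun_map_sum_chosen {θ n v : ℕ} (hθ : 1 ≤ θ) (t : ℝ) :
    charFun ((growthLaw θ).map
      fun ω => ∑ m ∈ Finset.Ico (label θ v) n, chosen θ v m (ω m)) t =
      ∏ m ∈ Finset.Ico (label θ v) n, (1 + ((((θ : ℝ) - 1) * (1 / ((m : ℝ) + θ)) : ℝ) : ℂ) *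
        (Complex.exp (t * Complex.I) - 1)) := by
  have hind : iIndepFun (fun m (ω : ∀ n, Choice θ n) => chosen θ v m (ω m)) (growthLaw θ) :=
    iIndepFun_infinitePi fun _ => Measurable.of_discrete
  rw [iIndepFun.charFun_map_fun_finsetSum_eq_prod
    (fun m _ => (measurable_chosen θ v m).aemeasurable) (hind.restrict _), Finset.prod_apply]
  refine Finset.prod_congr rfl fun m hm => charFun_map_chosen hθ ?_ t
  have := (Finset.mem_Ico.1 hm).1
  unfold label at this
  omega

/-- The initial hyperedge and the centring give the phase factor, and independence gives the
product. The case `s = 0` is covered: both sides are then `1`. -/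
lemma charFun_map_affine_containment {θ n v : ℕ} (hθ : 1 ≤ θ) (h : label θ v ≤ n) (a s t : ℝ) :
    charFun ((growthLaw θ).map fun ω => ((containment θ n v ω : ℝ) - a) / s) t =
      Complex.exp ((t / s : ℝ) * (1 - a : ℝ) * Complex.I) *
      ∏ m ∈ Finset.Ico (label θ v) n, (1 + ((((θ : ℝ) - 1) * (1 / ((m : ℝ) + θ)) : ℝ) : ℂ) *
        (Complex.exp ((t / s : ℝ) * Complex.I) - 1)) := by
  have hS : Measurable fun ω : ∀ n, Choice θ n =>
      ∑ m ∈ Finset.Ico (label θ v) n, chosen θ v m (ω m) :=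
    Finset.measurable_sum _ fun m _ => measurable_chosen θ v m
  have hC : Measurable fun ω => ((containment θ n v ω : ℝ) - a) / s :=
    ((measurable_from_nat.comp (measurable_containment θ n v)).sub_const a).div_const s
  rw [← charFun_map_sum_chosen hθ, charFun_apply_real, charFun_apply_real,
    integral_map hC.aemeasurable (by fun_prop), integral_map hS.aemeasurable (by fun_prop),
    ← integral_const_mul]
  refine integral_congr_ae (Eventually.of_forall fun ω => ?_)
  simp only
  rw [← Complex.exp_add, containment_eq_one_add_sum ω h]
  congr 1
  push_cast
  ring

lemma norm_charFun_sub_exp_le {θ n v : ℕ} (hθ : 1 ≤ θ) (h : label θ v ≤ n) (a s t : ℝ) :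
    ‖charFun ((growthLaw θ).map fun ω => ((containment θ n v ω : ℝ) - a) / s) t -
      Complex.exp ((t / s : ℝ) * (1 - a : ℝ) * Complex.I +
        (Complex.exp ((t / s : ℝ) * Complex.I) - 1) *
          ((∑ m ∈ Finset.Ico (label θ v) n, ((θ : ℝ) - 1) * (1 / ((m : ℝ) + θ)) : ℝ) : ℂ))‖ ≤
      ‖Complex.exp ((t / s : ℝ) * Complex.I) - 1‖ ^ 2 * Real.exp 2 *
        (((θ : ℝ) - 1) ^ 2 * (2 * (1 / ((label θ v : ℝ) + θ)))) := by
  have hθ' : (1 : ℝ) ≤ θ := by exact_mod_cast hθ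
  have h0 : (0 : ℝ) ≤ 1 / ((n : ℝ) + θ) := by positivity
  rw [charFun_map_affine_containment hθ h, Complex.exp_add, ← mul_sub, norm_mul,
    ← Complex.ofReal_mul, Complex.norm_exp_ofReal_mul_I, one_mul]
  refine (norm_prod_bernoulli_sub_exp_le _ _ (fun m _ => ?_) (fun m _ => ?_) _).trans ?_
  · exact mul_nonneg (by linarith) (by positivity)
  · rw [mul_one_div, div_le_one (by positivity)]
    linarith [m.cast_nonneg (α := ℝ)]
  · gcongr
    simp_rw [mul_pow, ← Finset.mul_sum]
    gcongr
    exact (sum_inv_sq_le hθ h).trans (by linarith)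

lemma tendstoInDistribution_of_tendsto_charFun {Ω Ω' : Type*} [MeasurableSpace Ω]
    [MeasurableSpace Ω'] {P : Measure Ω} [IsProbabilityMeasure P] {P' : Measure Ω'}
    [IsProbabilityMeasure P'] {X : ℕ → Ω → ℝ} {Z : Ω' → ℝ} (hX : ∀ n, AEMeasurable (X n) P)
    (hZ : AEMeasurable Z P')
    (h : ∀ t, Tendsto (fun n => charFun (P.map (X n)) t) atTop (𝓝 (charFun (P'.map Z) t))) :
    TendstoInDistribution X atTop Z (fun _ => P) P' where
  forall_aemeasurable := hX
  aemeasurable_limit := hZ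
  tendsto := ProbabilityMeasure.tendsto_iff_tendsto_charFun.2 h

lemma aemeasurable_affine_containment (θ n v : ℕ) (a s : ℝ) :
    AEMeasurable (fun ω => ((containment θ n v ω : ℝ) - a) / s) (growthLaw θ) :=
  (((measurable_from_nat.comp (measurable_containment θ n v)).sub_const a).div_const s).aemeasurable

theorem tendstoInDistribution_gaussian {θ : ℕ} (hθ : 1 ≤ θ) {v : ℕ → ℕ} {L : ℕ → ℝ} {K : ℝ}
    (hv : ∀ᶠ n in atTop, label θ (v n) ≤ n) (hL : Tendsto L atTop atTop)
    (hK : ∀ᶠ n : ℕ in atTop, |∑ m ∈ Finset.Ico (label θ (v n)) n,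
      ((θ : ℝ) - 1) * (1 / ((m : ℝ) + θ)) - ((θ : ℝ) - 1) * L n| ≤ K) :
    TendstoInDistribution
      (fun (n : ℕ) ω => ((containment θ n (v n) ω : ℝ) - ((θ : ℝ) - 1) * L n) / √(L n))
      atTop (fun x : ℝ => x) (fun _ => growthLaw θ) (gaussianReal 0 ((θ - 1 : ℕ) : ℝ≥0)) := by
  have hθ' : (1 : ℝ) ≤ θ := by exact_mod_cast hθ
  refine tendstoInDistribution_of_tendsto_charFun
    (fun n => aemeasurable_affine_containment _ _ _ _ _) aemeasurable_id fun t => ?_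
  have hu : Tendsto (fun n => t / √(L n)) atTop (𝓝 0) :=
    tendsto_const_nhds.div_atTop (Real.tendsto_sqrt_atTop.comp hL)
  have hz : Tendsto (fun n => Complex.exp ((t / √(L n) : ℝ) * Complex.I) - 1) atTop (𝓝 0) := by
    have huC : Tendsto (fun n => ((t / √(L n) : ℝ) : ℂ) * Complex.I) atTop (𝓝 0) := by
      simpa using ((Complex.continuous_ofReal.tendsto 0).comp hu).mul_const Complex.I
    simpa using ((Complex.continuous_exp.tendsto 0).comp huC).sub_const 1
  have hE := (Complex.continuous_exp.tendsto _).comp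
    (tendsto_gaussian_exponent (c := (θ : ℝ) - 1) (by linarith) hL hK t)
  have hlim : charFun ((gaussianReal 0 ((θ - 1 : ℕ) : ℝ≥0)).map fun x => x) t =
      Complex.exp (-(((((θ : ℝ) - 1) * t ^ 2 / 2 : ℝ)) : ℂ)) := by
    rw [Measure.map_id', charFun_gaussianReal]
    congr 1
    have : (((θ - 1 : ℕ) : ℝ≥0) : ℝ) = θ - 1 := by
      rw [NNReal.coe_natCast, Nat.cast_sub hθ, Nat.cast_one]
    rw [this]
    push_cast
    ring
  rw [hlim]
  have hD : Tendsto (fun n => charFun ((growthLaw θ).map fun ω =>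
      ((containment θ n (v n) ω : ℝ) - ((θ : ℝ) - 1) * L n) / √(L n)) t -
      Complex.exp ((t / √(L n) : ℝ) * (1 - ((θ : ℝ) - 1) * L n : ℝ) * Complex.I +
        (Complex.exp ((t / √(L n) : ℝ) * Complex.I) - 1) *
          ((∑ m ∈ Finset.Ico (label θ (v n)) n, ((θ : ℝ) - 1) * (1 / ((m : ℝ) + θ)) : ℝ) : ℂ)))
      atTop (𝓝 0) := by
    -- The crude bound `1 / (k + θ) ≤ 1` is enough, since the prefactor tends to `0`.
    refine squeeze_zero_norm' (a := fun n => ‖Complex.exp ((t / √(L n) : ℝ) * Complex.I) - 1‖ ^ 2 *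
      Real.exp 2 * (((θ : ℝ) - 1) ^ 2 * (2 * (1 / 1)))) ?_ ?_
    · filter_upwards [hv] with n hn
      refine (norm_charFun_sub_exp_le hθ hn _ _ t).trans ?_
      gcongr
      linarith [(label θ (v n)).cast_nonneg (α := ℝ)]
    · simpa using ((hz.norm.pow 2).mul_const (Real.exp 2)).mul_const
        (((θ : ℝ) - 1) ^ 2 * (2 * (1 / 1)))
  simpa using hD.add hE

theorem tendstoInDistribution_poisson {θ : ℕ} (hθ : 1 ≤ θ) {v : ℕ → ℕ} {r : ℝ≥0}
    (hv : ∀ᶠ n in atTop, label θ (v n) ≤ n) (hk : Tendsto (fun n => label θ (v n)) atTop atTop)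
    (hr : Tendsto (fun n : ℕ => ∑ m ∈ Finset.Ico (label θ (v n)) n,
      ((θ : ℝ) - 1) * (1 / ((m : ℝ) + θ))) atTop (𝓝 r)) :
    TendstoInDistribution (fun (n : ℕ) ω => (containment θ n (v n) ω : ℝ))
      atTop (fun j : ℕ => 1 + (j : ℝ)) (fun _ => growthLaw θ) (poissonMeasure r) := by
  refine tendstoInDistribution_of_tendsto_charFun
    (fun n => by simpa using aemeasurable_affine_containment θ n (v n) 0 1)
    AEMeasurable.of_discrete fun t => ?_
  have hlim : charFun ((poissonMeasure r).map fun j : ℕ => 1 + (j : ℝ)) t =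
      Complex.exp (t * Complex.I + (Complex.exp (t * Complex.I) - 1) * ((r : ℝ) : ℂ)) := by
    have h1 : (poissonMeasure r).map (fun j : ℕ => 1 + (j : ℝ)) =
        ((poissonMeasure r).map (Nat.cast : ℕ → ℝ)).map (1 + ·) := by
      rw [Measure.map_map (by fun_prop) (by fun_prop)]
      rfl
    rw [h1, charFun_map_const_add, charFun_map_cast_poissonMeasure, ← Complex.exp_add]
    congr 1
    simp
    ring
  rw [hlim]
  have hE := (Complex.continuous_exp.tendsto _).comp
    ((((Complex.continuous_ofReal.tendsto _).comp hr).const_mul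
      (Complex.exp (t * Complex.I) - 1)).const_add (t * Complex.I))
  have hD : Tendsto (fun n => charFun ((growthLaw θ).map fun ω =>
      (containment θ n (v n) ω : ℝ)) t -
      Complex.exp (t * Complex.I + (Complex.exp (t * Complex.I) - 1) *
          ((∑ m ∈ Finset.Ico (label θ (v n)) n, ((θ : ℝ) - 1) * (1 / ((m : ℝ) + θ)) : ℝ) : ℂ)))
      atTop (𝓝 0) := by
    -- Here the prefactor is fixed, and `1 / (k + θ) → 0` does the work.
    refine squeeze_zero_norm' (a := fun n => ‖Complex.exp (t * Complex.I) - 1‖ ^ 2 *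
      Real.exp 2 * (((θ : ℝ) - 1) ^ 2 * (2 * (1 / ((label θ (v n) : ℝ) + θ))))) ?_ ?_
    · filter_upwards [hv] with n hn
      simpa using norm_charFun_sub_exp_le hθ hn 0 1 t
    · have h : Tendsto (fun n => 1 / ((label θ (v n) : ℝ) + θ)) atTop (𝓝 0) :=
        tendsto_const_nhds.div_atTop
          (tendsto_atTop_add_const_right _ _ (tendsto_natCast_atTop_atTop.comp hk))
      simpa using ((h.const_mul 2).const_mul (((θ : ℝ) - 1) ^ 2)).const_mul
        (‖Complex.exp (t * Complex.I) - 1‖ ^ 2 * Real.exp 2)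
  simpa using hD.add hE

/-- Union bound: the level differs from `1` only if some later step chooses the vertex. -/
lemma growthLaw_real_containment_ne_one_le {θ n v : ℕ} (hθ : 1 ≤ θ) (h : label θ v ≤ n) :
    (growthLaw θ).real {ω | containment θ n v ω ≠ 1} ≤
      ∑ m ∈ Finset.Ico (label θ v) n, ((θ : ℝ) - 1) * (1 / ((m : ℝ) + θ)) := by
  have hsub : {ω : ∀ n, Choice θ n | containment θ n v ω ≠ 1} ⊆
      ⋃ m ∈ Finset.Ico (label θ v) n, {ω | v ∈ (ω m).1} := by
    intro ω hω
    by_contra hcon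
    simp only [Set.mem_iUnion, Set.mem_ofPred_eq, not_exists] at hcon
    refine hω ?_
    have h1 := containment_eq_one_add_sum ω h
    have h0 : ∀ m ∈ Finset.Ico (label θ v) n, chosen θ v m (ω m) = 0 :=
      fun m hm => if_neg (hcon m hm)
    rw [Finset.sum_eq_zero h0, add_zero] at h1
    exact_mod_cast h1
  refine (measureReal_mono hsub (measure_ne_top _ _)).trans ((measureReal_biUnion_finset_le _ _).trans
    (Finset.sum_le_sum fun m hm => (growthLaw_real_mem hθ ?_).le))
  have := (Finset.mem_Ico.1 hm).1
  unfold label at this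
  omega

theorem tendstoInMeasure_one {θ : ℕ} (hθ : 1 ≤ θ) {v : ℕ → ℕ}
    (hv : ∀ᶠ n in atTop, label θ (v n) ≤ n)
    (hr : Tendsto (fun n : ℕ => ∑ m ∈ Finset.Ico (label θ (v n)) n,
      ((θ : ℝ) - 1) * (1 / ((m : ℝ) + θ))) atTop (𝓝 0)) :
    TendstoInMeasure (growthLaw θ) (fun (n : ℕ) ω => (containment θ n (v n) ω : ℝ))
      atTop (fun _ => (1 : ℝ)) := by
  rw [tendstoInMeasure_iff_measureReal_dist]
  intro ε hε
  refine squeeze_zero' (Eventually.of_forall fun _ => measureReal_nonneg) ?_ hr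
  filter_upwards [hv] with n hn
  refine (measureReal_mono fun ω hω => ?_).trans (growthLaw_real_containment_ne_one_le hθ hn)
  intro h1
  simp only [Set.mem_ofPred_eq, h1, Nat.cast_one, dist_self] at hω
  linarith

end Probability

/-! ### Asymptotics of the mean -/

section Asymptotics

lemma sum_sub_log_bounds {θ k n : ℕ} (hθ : 1 ≤ θ) (hkn : k ≤ n) :
    |∑ m ∈ Finset.Ico k n, ((θ : ℝ) - 1) * (1 / ((m : ℝ) + θ)) -
      ((θ : ℝ) - 1) * (Real.log ((n : ℝ) + θ) - Real.log ((k : ℝ) + θ))| ≤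
      ((θ : ℝ) - 1) * (1 / ((k : ℝ) + θ)) := by
  have hθ' : (1 : ℝ) ≤ θ := by exact_mod_cast hθ
  have h := sum_inv_sub_log_bounds hθ hkn
  have hn : (0 : ℝ) ≤ 1 / ((n : ℝ) + θ) := by positivity
  rw [← Finset.mul_sum, ← mul_sub, abs_mul, abs_of_nonneg (by linarith : (0 : ℝ) ≤ θ - 1)]
  gcongr
  rw [abs_of_nonneg h.1]
  linarith [h.2]

/-- Allows any normalizer `x` within bounded distance of the logarithmic difference; the extra `1`
bounds the error `1 / (k + θ)` of the harmonic sum. -/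
lemma abs_sum_sub_le {θ k n : ℕ} (hθ : 1 ≤ θ) (hkn : k ≤ n) {x B : ℝ}
    (hx : |Real.log ((n : ℝ) + θ) - Real.log ((k : ℝ) + θ) - x| ≤ B) :
    |∑ m ∈ Finset.Ico k n, ((θ : ℝ) - 1) * (1 / ((m : ℝ) + θ)) - ((θ : ℝ) - 1) * x| ≤
      ((θ : ℝ) - 1) * (1 + B) := by
  have hθ' : (1 : ℝ) ≤ θ := by exact_mod_cast hθ
  have h1 : 1 / ((k : ℝ) + θ) ≤ 1 := by
    rw [div_le_one (by positivity)]
    linarith [k.cast_nonneg (α := ℝ)]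
  have h0 : (0 : ℝ) ≤ θ - 1 := by linarith
  have h2 : |((θ : ℝ) - 1) * (Real.log ((n : ℝ) + θ) - Real.log ((k : ℝ) + θ)) -
      ((θ : ℝ) - 1) * x| ≤ ((θ : ℝ) - 1) * B := by
    rw [← mul_sub, abs_mul, abs_of_nonneg h0]
    gcongr
  have h3 := (sum_sub_log_bounds hθ hkn).trans (mul_le_mul_of_nonneg_left h1 h0)
  refine (abs_sub_le _ _ _).trans ((add_le_add h3 h2).trans (le_of_eq ?_))
  ring

/-- Since `k → ∞`, the error `1 / (k + θ)` vanishes, and `(n + θ) / (k + θ) → 1 / α`. The value `α =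
1` is allowed, for use in (iv). -/
lemma tendsto_sum_of_tendsto_ratio {θ : ℕ} (hθ : 1 ≤ θ) {k : ℕ → ℕ} (hkn : ∀ n, k n ≤ n) {α : ℝ}
    (hα : 0 < α) (hk : Tendsto (fun n : ℕ => (k n : ℝ) / n) atTop (𝓝 α)) :
    Tendsto k atTop atTop ∧ Tendsto (fun n : ℕ => ∑ m ∈ Finset.Ico (k n) n,
      ((θ : ℝ) - 1) * (1 / ((m : ℝ) + θ))) atTop (𝓝 (((θ : ℝ) - 1) * Real.log (1 / α))) := by
  have hkR : Tendsto (fun n => (k n : ℝ)) atTop atTop := by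
    refine (hk.pos_mul_atTop hα tendsto_natCast_atTop_atTop).congr' ?_
    filter_upwards [eventually_gt_atTop 0] with n hn
    have : (n : ℝ) ≠ 0 := by exact_mod_cast hn.ne'
    field_simp
  refine ⟨tendsto_natCast_atTop_iff.1 hkR, ?_⟩
  have hθn : Tendsto (fun n : ℕ => (θ : ℝ) / n) atTop (𝓝 0) :=
    tendsto_const_nhds.div_atTop tendsto_natCast_atTop_atTop
  have hr : Tendsto (fun n : ℕ => (1 + (θ : ℝ) / n) / ((k n : ℝ) / n + θ / n)) atTop
      (𝓝 (1 / α)) := by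
    have h := (hθn.const_add 1).div (hk.add hθn) (by simpa using hα.ne')
    rw [add_zero, add_zero] at h
    exact h
  have hlog : Tendsto (fun n : ℕ => ((θ : ℝ) - 1) *
      (Real.log ((n : ℝ) + θ) - Real.log ((k n : ℝ) + θ))) atTop
      (𝓝 (((θ : ℝ) - 1) * Real.log (1 / α))) := by
    refine ((hr.log (by positivity)).congr' ?_).const_mul _
    filter_upwards [eventually_gt_atTop 0] with n hn
    have hn' : (0 : ℝ) < n := by exact_mod_cast hn
    have hθ' : (0 : ℝ) < θ := by exact_mod_cast hθ
    rw [← Real.log_div (by positivity) (by positivity)]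
    congr 1
    field_simp
  have hD : Tendsto (fun n : ℕ => ∑ m ∈ Finset.Ico (k n) n, ((θ : ℝ) - 1) * (1 / ((m : ℝ) + θ)) -
      ((θ : ℝ) - 1) * (Real.log ((n : ℝ) + θ) - Real.log ((k n : ℝ) + θ))) atTop (𝓝 0) := by
    refine squeeze_zero_norm (fun n => sum_sub_log_bounds hθ (hkn n)) ?_
    simpa using (tendsto_const_nhds (x := (1 : ℝ)).div_atTop
      (tendsto_atTop_add_const_right _ (θ : ℝ) hkR)).const_mul ((θ : ℝ) - 1)
  simpa using hD.add hlog

end Asymptotics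

end HyperrecursiveTree

/-! ### The four regimes -/

open HyperrecursiveTree in
theorem mainTheorem1 (θ : ℕ) (hθ : 1 ≤ θ) :
    -- (i) `k` fixed
    (∀ k v : ℕ, HyperrecursiveTree.label θ v = k →
      TendstoInDistribution
        (fun (n : ℕ) ω =>
          ((HyperrecursiveTree.containment θ n v ω : ℝ) - ((θ : ℝ) - 1) * Real.log (n : ℝ)) /
            √(Real.log (n : ℝ)))
        atTop (fun x : ℝ => x) (fun _ => HyperrecursiveTree.growthLaw θ)
        (gaussianReal 0 ((θ - 1 : ℕ) : ℝ≥0))) ∧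
    -- `k = k(n)` varies with `n`, and `v n` is a vertex labeled `k n`
    (∀ k v : ℕ → ℕ, (∀ n, k n ≤ n) → (∀ n, HyperrecursiveTree.label θ (v n) = k n) →
      -- (ii) `k → ∞` and `k = o(n)`
      (Tendsto k atTop atTop →
        (fun n => (k n : ℝ)) =o[atTop] (fun n : ℕ => (n : ℝ)) →
        TendstoInDistribution
          (fun (n : ℕ) ω =>
            ((HyperrecursiveTree.containment θ n (v n) ω : ℝ)
                - ((θ : ℝ) - 1) * Real.log ((n : ℝ) / (k n : ℝ))) /
              √(Real.log ((n : ℝ) / (k n : ℝ))))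
          atTop (fun x : ℝ => x) (fun _ => HyperrecursiveTree.growthLaw θ)
          (gaussianReal 0 ((θ - 1 : ℕ) : ℝ≥0))) ∧
      -- (iii) `k ∼ α n` with `0 < α < 1`
      (∀ α : ℝ, 0 < α → α < 1 →
        (fun n => (k n : ℝ)) ~[atTop] (fun n : ℕ => α * (n : ℝ)) →
        TendstoInDistribution
          (fun (n : ℕ) ω => (HyperrecursiveTree.containment θ n (v n) ω : ℝ))
          atTop (fun j : ℕ => 1 + (j : ℝ)) (fun _ => HyperrecursiveTree.growthLaw θ)
          (poissonMeasure (Real.toNNReal (((θ : ℝ) - 1) * Real.log (1 / α))))) ∧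
      -- (iv) `k = n - o(n)`
      ((fun n : ℕ => (n : ℝ) - (k n : ℝ)) =o[atTop] (fun n : ℕ => (n : ℝ)) →
        TendstoInMeasure (HyperrecursiveTree.growthLaw θ)
          (fun (n : ℕ) ω => (HyperrecursiveTree.containment θ n (v n) ω : ℝ))
          atTop (fun _ => (1 : ℝ)))) := by
  
  have hθ0 : (0 : ℝ) ≤ θ := θ.cast_nonneg
  refine ⟨fun k v hk => ?_, fun k v hkn hv => ⟨fun hk hkn' => ?_, fun α hα hα1 hkα => ?_,
    fun hk => ?_⟩⟩
  · subst hk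
    refine tendstoInDistribution_gaussian hθ (eventually_ge_atTop (label θ v))
      (Real.tendsto_log_atTop.comp tendsto_natCast_atTop_atTop)
      -- `log (1 + θ)` pays for replacing `log (n + θ)` by `log n`; `log (k + θ)` is constant as `k`
      -- is fixed.
      (K := ((θ : ℝ) - 1) * (1 + (Real.log (1 + θ) + |Real.log ((label θ v : ℝ) + θ)|))) ?_
    filter_upwards [eventually_ge_atTop (label θ v), eventually_ge_atTop 1] with n hn hn1
    have h := log_add_sub_log_bounds (x := n) (by exact_mod_cast hn1) hθ0
    refine abs_sum_sub_le hθ hn ?_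
    rw [sub_right_comm]
    refine (abs_sub _ _).trans (add_le_add ?_ le_rfl)
    rw [abs_of_nonneg h.1]
    exact h.2
  · have hk1 : ∀ᶠ n in atTop, 1 ≤ k n := hk.eventually_ge_atTop 1
    have hL : Tendsto (fun n : ℕ => Real.log ((n : ℝ) / (k n : ℝ))) atTop atTop := by
      refine Real.tendsto_log_atTop.comp ?_
      have h0 : Tendsto (fun n : ℕ => (k n : ℝ) / n) atTop (𝓝[>] 0) := by
        refine tendsto_nhdsWithin_iff.2 ⟨hkn'.tendsto_div_nhds_zero, ?_⟩
        filter_upwards [hk1] with n hn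
        have h1 : (0 : ℝ) < k n := by exact_mod_cast hn
        have h2 : (0 : ℝ) < n := by exact_mod_cast hn.trans (hkn n)
        exact div_pos h1 h2
      refine h0.inv_tendsto_nhdsGT_zero.congr fun n => ?_
      rw [Pi.inv_apply, inv_div]
    refine tendstoInDistribution_gaussian hθ
      (Eventually.of_forall fun n => (hv n).trans_le (hkn n)) hL
      (K := ((θ : ℝ) - 1) * (1 + Real.log (1 + θ))) ?_
    filter_upwards [hk1] with n hn
    rw [hv n]
    refine abs_sum_sub_le hθ (hkn n) ?_
    have hk0 : (1 : ℝ) ≤ k n := by exact_mod_cast hn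
    have hn0 : (1 : ℝ) ≤ n := by exact_mod_cast hn.trans (hkn n)
    have h1 := log_add_sub_log_bounds hk0 hθ0
    have h2 := log_add_sub_log_bounds hn0 hθ0
    -- The shifts by `θ` in `n` and in `k` each cost between `0` and `log (1 + θ)`, hence so does
    -- their difference in absolute value.
    rw [Real.log_div (by positivity) (by positivity), abs_le]
    constructor <;> linarith [h1.1, h1.2, h2.1, h2.2]
  · have hratio : Tendsto (fun n : ℕ => (k n : ℝ) / n) atTop (𝓝 α) := by
      have hne : ∀ᶠ n : ℕ in atTop, α * (n : ℝ) ≠ 0 := by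
        filter_upwards [eventually_gt_atTop 0] with n hn
        have : (n : ℝ) ≠ 0 := by exact_mod_cast hn.ne'
        positivity
      have h := ((isEquivalent_iff_tendsto_one hne).1 hkα).const_mul α
      rw [mul_one] at h
      refine h.congr' ?_
      filter_upwards [hne] with n hn
      have h2 : (n : ℝ) ≠ 0 := right_ne_zero_of_mul hn
      simp only [Pi.div_apply]
      field_simp
    obtain ⟨h1, h2⟩ := tendsto_sum_of_tendsto_ratio hθ hkn hα hratio
    have hθ' : (1 : ℝ) ≤ θ := by exact_mod_cast hθ
    refine tendstoInDistribution_poisson hθ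
      (Eventually.of_forall fun n => (hv n).trans_le (hkn n)) (by simpa only [hv] using h1) ?_
    -- `α < 1` makes the Poisson mean nonnegative, so `toNNReal` does not truncate it.
    rw [Real.coe_toNNReal _ (mul_nonneg (by linarith)
      (Real.log_nonneg ((one_le_div hα).2 hα1.le)))]
    simpa only [hv] using h2
  · have hratio : Tendsto (fun n : ℕ => (k n : ℝ) / n) atTop (𝓝 1) := by
      have h := hk.tendsto_div_nhds_zero.const_sub 1
      rw [sub_zero] at h
      refine h.congr' ?_
      filter_upwards [eventually_gt_atTop 0] with n hn
      have : (n : ℝ) ≠ 0 := by exact_mod_cast hn.ne'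
      field_simp
      ring
    -- The limiting mean is `(θ - 1) log 1 = 0`.
    have h := (tendsto_sum_of_tendsto_ratio hθ hkn one_pos hratio).2
    rw [div_one, Real.log_one, mul_zero] at h
    exact tendstoInMeasure_one hθ (Eventually.of_forall fun n => (hv n).trans_le (hkn n))
      (by simpa only [hv] using h)
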